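/- Let $\Bbbk$ be an algebraically closed field, $A$ a finite dimensional unital associative $\Bbbk$-algebra, and $A\text{-}\mathrm{mod}$ the category of finite dimensional left $A$-modules. Let $\mathrm{F}$ be an additive $\Bbbk$-linear endofunctor of $A\text{-}\mathrm{mod}$ that is selfadjoint (i.e. $\mathrm{F}$ is left, equivalently right, adjoint to itself) and satisfies $\mathrm{F}\circ\mathrm{F}\cong\mathrm{F}$. Then there is an isomorphism of $\Bbbk$-algebras $A\cong B\oplus C$, where each of $B$ and $C$ is a unital $\Bbbk$-algebra or zero, such that $\mathrm{F}\cong\mathfrak{p}_B$. Here $\mathfrak{p}_B=\mathrm{ID}\boxplus\mathbf{0}$ is the endofunctor of $A\text{-}\mathrm{mod}=B\text{-}\mathrm{mod}\oplus C\text{-}\mathrm{mod}$ which acts componentwise, as the identity functor on the component in $B\text{-}\mathrm{mod}$ and as the zero functor on the component in $C\text{-}\mathrm{mod}$. -/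

import Mathlib

open CategoryTheory

universe u v w

namespace AlgebraDecomposition

section Component

variable {A : Type u} {B : Type v} {C : Type w} [Ring A] [Ring B] [Ring C]

/-- The central idempotent `1_B` of `A` belonging to the summand `B` of a decomposition
`A ≅ B × C` of rings. -/
def idem (e : A ≃+* B × C) : A := e.symm (1, 0)

theorem idem_mul (e : A ≃+* B × C) (b : B) : idem e * e.symm (b, 0) = e.symm (b, 0) := by
  simp [idem, ← map_mul]

theorem idem_mul_idem (e : A ≃+* B × C) : idem e * idem e = idem e := idem_mul e 1

theorem symm_fst_zero (e : A ≃+* B × C) (a : A) : e.symm ((e a).1, 0) = idem e * a := by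
  apply e.injective
  ext <;> simp [idem]

theorem idem_comm (e : A ≃+* B × C) (a : A) : idem e * a = a * idem e := by
  apply e.injective
  ext <;> simp [idem]

/-- The `B`-component `1_B M` of an `A`-module `M`, for a decomposition `A ≅ B × C`. -/
def component (e : A ≃+* B × C) (M : Type*) [AddCommGroup M] [Module A M] : AddSubgroup M :=
  (DistribSMul.toAddMonoidHom M (idem e)).range

theorem mem_component {e : A ≃+* B × C} {M : Type*} [AddCommGroup M] [Module A M] {m : M} :
    m ∈ component e M ↔ idem e • m = m := by
  constructor
  · rintro ⟨n, rfl⟩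
    simp [smul_smul, idem_mul_idem]
  · intro h
    exact ⟨m, h⟩

/-- `B` acts on `1_B M` through `b ↦ (b, 0)`. -/
instance componentModule (e : A ≃+* B × C) (M : Type*) [AddCommGroup M] [Module A M] :
    Module B (component e M) where
  smul b m := ⟨e.symm (b, 0) • (m : M), by
    rw [mem_component, smul_smul, idem_mul]⟩
  one_smul m := Subtype.ext (mem_component.1 m.2)
  mul_smul b c m := Subtype.ext <| by
    change e.symm (b * c, 0) • (m : M) = e.symm (b, 0) • e.symm (c, 0) • (m : M)
    rw [smul_smul, ← map_mul, Prod.mk_mul_mk, mul_zero]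
  smul_zero b := Subtype.ext (smul_zero (e.symm (b, 0)))
  smul_add b m n := Subtype.ext (smul_add (e.symm (b, 0)) (m : M) (n : M))
  add_smul b c m := Subtype.ext <| by
    change e.symm (b + c, 0) • (m : M) = e.symm (b, 0) • (m : M) + e.symm (c, 0) • (m : M)
    rw [← add_smul, ← map_add, Prod.mk_add_mk, add_zero]
  zero_smul m := Subtype.ext <| by
    change e.symm ((0 : B), (0 : C)) • (m : M) = 0
    rw [← Prod.zero_eq_mk, map_zero, zero_smul]

theorem coe_smul (e : A ≃+* B × C) {M : Type*} [AddCommGroup M] [Module A M] (b : B)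
    (m : component e M) : ((b • m : component e M) : M) = e.symm (b, 0) • (m : M) := rfl

/-- The projection `m ↦ 1_B m`, semilinear over the ring projection `A → B`. -/
def toComponent (e : A ≃+* B × C) (M : Type*) [AddCommGroup M] [Module A M] :
    M →ₛₗ[(RingHom.fst B C).comp (e : A →+* B × C)] component e M where
  toFun m := ⟨idem e • m, m, rfl⟩
  map_add' m n := Subtype.ext (smul_add _ _ _)
  map_smul' a m := Subtype.ext <| by
    change idem e • a • m = e.symm ((e a).1, 0) • idem e • m
    rw [symm_fst_zero, smul_smul, smul_smul, mul_assoc, ← idem_comm e a, ← mul_assoc,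
      idem_mul_idem]

instance component_finite (e : A ≃+* B × C) (M : Type*) [AddCommGroup M] [Module A M]
    [Module.Finite A M] : Module.Finite B (component e M) := by
  have : RingHomSurjective ((RingHom.fst B C).comp (e : A →+* B × C)) :=
    ⟨fun b => ⟨e.symm (b, 0), by simp⟩⟩
  refine Module.Finite.of_surjective (toComponent e M) ?_
  rintro ⟨_, n, rfl⟩
  exact ⟨n, rfl⟩

/-- The restriction `1_B M → 1_B N` of an `A`-linear map `M → N`. -/
def componentMap (e : A ≃+* B × C) {M N : Type*} [AddCommGroup M] [Module A M]
    [AddCommGroup N] [Module A N] (f : M →ₗ[A] N) : component e M →ₗ[B] component e N where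
  toFun m := ⟨f m, by rw [mem_component, ← map_smul, mem_component.1 m.2]⟩
  map_add' m n := Subtype.ext (map_add f (m : M) (n : M))
  map_smul' b m := Subtype.ext (map_smul f (e.symm (b, 0)) (m : M))

/-- The `A`-module structure `a • (x, y) = (b • x, c • y)`, where `a` corresponds to `(b, c)`,
on the product of a `B`-module and a `C`-module. -/
abbrev prodModule (e : A ≃+* B × C) (X Y : Type*) [AddCommGroup X] [AddCommGroup Y]
    [Module B X] [Module C Y] : Module A (X × Y) where
  smul a p := ((e a).1 • p.1, (e a).2 • p.2)
  one_smul p := by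
    change ((e 1).1 • p.1, (e 1).2 • p.2) = p
    simp
  mul_smul a b p := by
    change ((e (a * b)).1 • p.1, (e (a * b)).2 • p.2) =
      ((e a).1 • (e b).1 • p.1, (e a).2 • (e b).2 • p.2)
    simp [mul_smul]
  smul_zero a := by
    change ((e a).1 • (0 : X), (e a).2 • (0 : Y)) = 0
    simp
  smul_add a p q := by
    change ((e a).1 • (p.1 + q.1), (e a).2 • (p.2 + q.2)) =
      ((e a).1 • p.1, (e a).2 • p.2) + ((e a).1 • q.1, (e a).2 • q.2)
    simp
  add_smul a b p := by
    change ((e (a + b)).1 • p.1, (e (a + b)).2 • p.2) =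
      ((e a).1 • p.1, (e a).2 • p.2) + ((e b).1 • p.1, (e b).2 • p.2)
    simp [add_smul]
  zero_smul p := by
    change ((e 0).1 • p.1, (e 0).2 • p.2) = 0
    simp

theorem prodModule_finite (e : A ≃+* B × C) (X Y : Type*) [AddCommGroup X] [AddCommGroup Y]
    [Module B X] [Module C Y] [Module.Finite B X] [Module.Finite C Y] :
    letI := prodModule e X Y
    Module.Finite A (X × Y) := by
  let _ := prodModule e X Y
  have hs : ∀ (a : A) (p : X × Y), a • p = ((e a).1 • p.1, (e a).2 • p.2) := fun _ _ => rfl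
  obtain ⟨s, hs1⟩ := (Module.Finite.fg_top : (⊤ : Submodule B X).FG)
  obtain ⟨t, ht1⟩ := (Module.Finite.fg_top : (⊤ : Submodule C Y).FG)
  classical
  refine ⟨⟨s.image (fun x => (x, 0)) ∪ t.image (fun y => (0, y)), ?_⟩⟩
  set S := Submodule.span A
    ((s.image (fun x => ((x, 0) : X × Y)) ∪ t.image (fun y => ((0, y) : X × Y)) :
      Finset (X × Y)) : Set (X × Y)) with hS
  have h1 : ∀ x : X, ((x, 0) : X × Y) ∈ S := by
    intro x
    have hx : x ∈ Submodule.span B (s : Set X) := hs1 ▸ Submodule.mem_top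
    induction hx using Submodule.span_induction with
    | mem x hx => exact Submodule.subset_span (by simp_all)
    | zero => exact S.zero_mem
    | add x y _ _ hx hy => simpa using S.add_mem hx hy
    | smul b x _ hx => simpa [hs] using S.smul_mem (e.symm (b, 0)) hx
  have h2 : ∀ y : Y, ((0, y) : X × Y) ∈ S := by
    intro y
    have hy : y ∈ Submodule.span C (t : Set Y) := ht1 ▸ Submodule.mem_top
    induction hy using Submodule.span_induction with
    | mem x hx => exact Submodule.subset_span (by simp_all)
    | zero => exact S.zero_mem
    | add x y _ _ hx hy => simpa using S.add_mem hx hy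
    | smul c x _ hx => simpa [hs] using S.smul_mem (e.symm (0, c)) hx
  rw [eq_top_iff]
  rintro ⟨x, y⟩ -
  simpa using S.add_mem (h1 x) (h2 y)

end Component

section Functors

variable {A B C : Type u} [Ring A] [Ring B] [Ring C]

/-- The component functor `A-mod ⥤ B-mod`, `M ↦ 1_B M`. -/
def componentFunctor (e : A ≃+* B × C) : FGModuleCat.{u} A ⥤ FGModuleCat.{u} B where
  obj M := FGModuleCat.of B (component e M)
  map f := FGModuleCat.ofHom (componentMap e f.hom.hom)

/-- The swapped decomposition `A ≅ C × B`. -/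
abbrev swap (e : A ≃+* B × C) : A ≃+* C × B := e.trans RingEquiv.prodComm

/-- The functor `B-mod × C-mod ⥤ A-mod` which sends `(X, Y)` to `X × Y`, on which
`A ≅ B × C` acts componentwise. -/
def prodFunctor (e : A ≃+* B × C) :
    FGModuleCat.{u} B × FGModuleCat.{u} C ⥤ FGModuleCat.{u} A where
  obj P :=
    letI := prodModule e P.1 P.2
    haveI := prodModule_finite e P.1 P.2
    FGModuleCat.of A (P.1 × P.2)
  map {P Q} f :=
    letI := prodModule e P.1 P.2
    haveI := prodModule_finite e P.1 P.2
    letI := prodModule e Q.1 Q.2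
    haveI := prodModule_finite e Q.1 Q.2
    FGModuleCat.ofHom
      { toFun := fun p => (f.1.hom.hom p.1, f.2.hom.hom p.2)
        map_add' := fun p q => Prod.ext (map_add f.1.hom.hom p.1 q.1) (map_add f.2.hom.hom p.2 q.2)
        map_smul' := fun a p => Prod.ext (map_smul f.1.hom.hom (e a).1 p.1)
          (map_smul f.2.hom.hom (e a).2 p.2) }

/-- The external direct sum `F ⊞ G` on `A-mod`, for `A ≅ B × C`, of an endofunctor `F` of `B-mod`
and an endofunctor `G` of `C-mod`: it acts on `A`-modules componentwise. -/
def externalSum (e : A ≃+* B × C) (F : FGModuleCat.{u} B ⥤ FGModuleCat.{u} B)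
    (G : FGModuleCat.{u} C ⥤ FGModuleCat.{u} C) : FGModuleCat.{u} A ⥤ FGModuleCat.{u} A :=
  (componentFunctor e).prod' (componentFunctor (swap e)) ⋙ F.prod G ⋙ prodFunctor e

/-- The zero endofunctor. -/
def zeroFunctor (C : Type u) [Ring C] : FGModuleCat.{u} C ⥤ FGModuleCat.{u} C :=
  (Functor.const _).obj (FGModuleCat.of C PUnit.{u + 1})

/-- The projection `𝔭_B = ID ⊞ 0` with respect to a decomposition `A ≅ B × C`, as an endofunctor
of `A-mod`. -/
def projection (e : A ≃+* B × C) : FGModuleCat.{u} A ⥤ FGModuleCat.{u} A :=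
  externalSum e (𝟭 (FGModuleCat.{u} B)) (zeroFunctor C)

end Functors

end AlgebraDecomposition

/-! Let `η : 𝟭 ⟶ FF` and `ε : FF ⟶ 𝟭` be the unit and counit. The triangle identity makes `ε` at `F
M` a split epimorphism `FFFM ⟶ FM`; both sides are isomorphic Noetherian modules, so it is
invertible. Naturality of `ε` along `η` then makes `ε ≫ η` invertible, so `FF ≅ F` is a retract of
the identity functor. Natural endomorphisms of the identity are multiplications by central elements,
so the retract gives a central idempotent `z` with `F M ≅ z M`, and `z` splits `A`. -/

namespace AlgebraDecomposition

/-! ### Splitting an algebra along a central idempotent -/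

section CentralIdempotent

variable {k : Type v} [CommRing k] {A : Type u} [Ring A] [Algebra k A] {z : A}

/-- The corner ring of a central idempotent is an algebra. -/
abbrev cornerAlgebra (hz : IsIdempotentElem z) (hc : ∀ a, z * a = a * z) :
    Algebra k hz.Corner :=
  RingHom.toAlgebra'
    { toFun := fun r => ⟨z * algebraMap k A r * z, _, rfl⟩
      map_one' := Subtype.ext <| by
        change z * algebraMap k A 1 * z = z
        rw [map_one, mul_one, hz.eq]
      map_mul' := fun r s => Subtype.ext <| by
        change z * algebraMap k A (r * s) * z =
          z * algebraMap k A r * z * (z * algebraMap k A s * z)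
        simp only [← hc, ← mul_assoc, hz.eq, map_mul]
      map_zero' := Subtype.ext <| by
        change z * algebraMap k A 0 * z = 0
        simp
      map_add' := fun r s => Subtype.ext <| by
        change z * algebraMap k A (r + s) * z = z * algebraMap k A r * z + z * algebraMap k A s * z
        simp [mul_add, add_mul] }
    (fun r x => Subtype.ext <| by
      obtain ⟨x, hx⟩ := x
      change z * algebraMap k A r * z * x = x * (z * algebraMap k A r * z)
      have hzc : ∀ y, Commute z y := hc
      exact ((hzc x).mul_left (Algebra.commutes r x)).mul_left (hzc x))

/-- A central idempotent `z` decomposes an algebra as the product of the corners of `z` and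
`1 - z`. -/
theorem exists_algEquiv_prod_of_isIdempotentElem (k : Type v) [CommRing k] [Algebra k A]
    (hz : IsIdempotentElem z) (hc : ∀ a, z * a = a * z) :
    ∃ (B C : Type u) (_ : Ring B) (_ : Ring C) (_ : Algebra k B) (_ : Algebra k C)
      (e : A ≃ₐ[k] B × C), idem (e : A ≃+* B × C) = z := by
  have hc' : ∀ a, (1 - z) * a = a * (1 - z) := fun a => by simp [sub_mul, mul_sub, hc]
  have hz' := hz.one_sub
  have h0 : z * (1 - z) = 0 := by simp [mul_sub, hz.eq]
  have h0' : (1 - z) * z = 0 := by simp [sub_mul, hz.eq]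
  let _ := cornerAlgebra (k := k) hz hc
  let _ := cornerAlgebra (k := k) hz' hc'
  have key : ∀ {w : A}, IsIdempotentElem w → (∀ a, w * a = a * w) → ∀ a b,
      w * (a * b) * w = w * a * w * (w * b * w) := by
    intro w hw hcw a b
    simp only [← hcw, ← mul_assoc, hw.eq]
  have hfix : ∀ {w : A} (hw : IsIdempotentElem w) (x : hw.Corner), w * x.1 * w = x.1 := by
    rintro w hw ⟨_, a, rfl⟩
    change w * (w * a * w) * w = w * a * w
    simp only [← mul_assoc, hw.eq]
    rw [mul_assoc, hw.eq]
  have hkill : ∀ {w v : A} (hw : IsIdempotentElem w), v * w = 0 → ∀ x : hw.Corner,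
      v * x.1 = 0 := by
    rintro w v hw h ⟨_, a, rfl⟩
    change v * (w * a * w) = 0
    simp [← mul_assoc, h]
  let e : A ≃ₐ[k] hz.Corner × hz'.Corner :=
    { toFun := fun a => (⟨z * a * z, a, rfl⟩, ⟨(1 - z) * a * (1 - z), a, rfl⟩)
      invFun := fun p => p.1.1 + p.2.1
      left_inv := fun a => by
        change z * a * z + (1 - z) * a * (1 - z) = a
        rw [← hc', ← hc, ← mul_assoc, ← mul_assoc, hz.eq, hz'.eq, ← add_mul]
        simp
      right_inv := fun p => Prod.ext
        (Subtype.ext <| by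
          change z * (p.1.1 + p.2.1) * z = p.1.1
          rw [mul_add, add_mul, hkill hz' h0, hfix, zero_mul, add_zero])
        (Subtype.ext <| by
          change (1 - z) * (p.1.1 + p.2.1) * (1 - z) = p.2.1
          rw [mul_add, add_mul, hkill hz h0', hfix, zero_mul, zero_add])
      map_mul' := fun a b => Prod.ext (Subtype.ext (key hz hc a b)) (Subtype.ext (key hz' hc' a b))
      map_add' := fun a b => Prod.ext
        (Subtype.ext (show z * (a + b) * z = z * a * z + z * b * z by simp [mul_add, add_mul]))
        (Subtype.ext (show (1 - z) * (a + b) * (1 - z) =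
          (1 - z) * a * (1 - z) + (1 - z) * b * (1 - z) by rw [mul_add, add_mul]))
      -- The structure maps of the corners were defined by these same two-sided products.
      commutes' := fun r => rfl }
  refine ⟨hz.Corner, hz'.Corner, inferInstance, inferInstance, inferInstance, inferInstance, e, ?_⟩
  change z + 0 = z
  exact add_zero z

end CentralIdempotent

/-! ### From a selfadjunction to a retract of the identity -/

section Retract

/-- If `ε ≫ η` is invertible for morphisms `ε : X ⟶ Y` and `η : Y ⟶ X`, then `X` is a retract
of `Y`. -/
noncomputable def retractOfIsIso {D : Type*} [Category D] {X Y : D} (ε : X ⟶ Y) (η : Y ⟶ X) [IsIso (ε ≫ η)] :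
    Retract X Y where
  i := ε
  r := η ≫ inv (ε ≫ η)
  retract := by rw [← Category.assoc, IsIso.hom_inv_id]

/-- The composite of the counit and the unit of a selfadjunction is invertible where the counit is
invertible on the image of the functor. -/
theorem isIso_counit_comp_unit {D : Type*} [Category D] {F : D ⥤ D} (adj : F ⊣ F)
    (h : ∀ X, IsIso (adj.counit.app (F.obj X))) (X : D) :
    IsIso (adj.counit.app X ≫ adj.unit.app X) := by
  -- By the triangle identity this map is the inverse of the counit at `F.obj X`.
  have hF : IsIso (F.map (adj.unit.app X)) := by
    have := h X
    rw [(IsIso.eq_comp_inv _).2 (adj.left_triangle_components X)]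
    exact IsIso.comp_isIso' (IsIso.id _) IsIso.inv_isIso
  -- Naturality along `η : X ⟶ FFX` rewrites `ε ≫ η` as `FFη` followed by the counit at `FFX`, both
  -- invertible.
  have hnat := adj.counit.naturality (adj.unit.app X)
  change _ = adj.counit.app X ≫ adj.unit.app X at hnat
  rw [← hnat, Functor.comp_map]
  exact IsIso.comp_isIso' inferInstance (h (F.obj X))

variable {A : Type u} [Ring A]

/-- A split epimorphism between isomorphic Noetherian modules is invertible. -/
theorem isIso_of_comp_eq_id_of_iso [IsNoetherianRing A] {M N : FGModuleCat.{u} A} (f : M ⟶ N)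
    (s : N ⟶ M) (h : s ≫ f = 𝟙 N) (i : N ≅ M) : IsIso f := by
  -- A surjective endomorphism of a Noetherian module is bijective; `i` turns `f` into an
  -- endomorphism.
  have hs : Function.Surjective (f ≫ i.hom).hom.hom := fun m => by
    refine ⟨s.hom.hom (i.inv.hom.hom m), ?_⟩
    have := congr(($(show i.inv ≫ s ≫ f ≫ i.hom = 𝟙 M by
      rw [reassoc_of% h, i.inv_hom_id])).hom.hom m)
    exact this
  have hb := IsNoetherian.bijective_of_surjective_endomorphism (f ≫ i.hom).hom.hom hs
  have : IsIso (f ≫ i.hom) := (LinearEquiv.ofBijective _ hb).toFGModuleCatIso.isIso_hom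
  exact IsIso.of_isIso_comp_right f i.hom

/-- A selfadjoint idempotent endofunctor of the category of finitely generated modules over a
Noetherian ring is a retract of the identity functor. -/
theorem nonempty_retract_id [IsNoetherianRing A] {F : FGModuleCat.{u} A ⥤ FGModuleCat.{u} A}
    (adj : F ⊣ F) (i : F ⋙ F ≅ F) : Nonempty (Retract F (𝟭 _)) := by
  have h (M) : IsIso (adj.counit.app (F.obj M)) :=
    isIso_of_comp_eq_id_of_iso _ (F.map (adj.unit.app M)) (adj.left_triangle_components M)
      -- `FM ≅ FFM ≅ FFFM`; any isomorphism will do, unrelated to the counit.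
      ((i.app M).symm ≪≫ F.mapIso (i.app M).symm)
  have : IsIso (adj.counit ≫ adj.unit) := by
    rw [NatTrans.isIso_iff_isIso_app]
    exact isIso_counit_comp_unit adj h
  exact ⟨(Retract.ofIso i.symm).trans (retractOfIsIso adj.counit adj.unit)⟩

/-- A natural endomorphism of the identity functor acts as multiplication by its value at
`1 : A`. -/
theorem id_natTrans_apply (t : 𝟭 (FGModuleCat.{u} A) ⟶ 𝟭 _) (M : FGModuleCat.{u} A) (m : M) :
    (t.app M).hom.hom m = ((t.app (FGModuleCat.of A A)).hom.hom (1 : A) : A) • m := by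
  -- Naturality along the map `A ⟶ M` sending `1` to `m`.
  have := congr(($(t.naturality (X := FGModuleCat.of A A) (Y := M)
    (FGModuleCat.ofHom (LinearMap.toSpanSingleton A M m)))).hom.hom (1 : A))
  change (t.app M).hom.hom ((1 : A) • m) =
    ((t.app (FGModuleCat.of A A)).hom.hom (1 : A) : A) • m at this
  rwa [one_smul] at this

/-! ### Retracts of the identity as projections -/

variable {B C : Type u} [Ring B] [Ring C]

/-- A natural transformation to the identity functor with values in the `B`-component factors
through the projection. -/
def liftProjection (e : A ≃+* B × C) {F : FGModuleCat.{u} A ⥤ FGModuleCat.{u} A} (t : F ⟶ 𝟭 _)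
    (ht : ∀ M (x : F.obj M), (t.app M).hom.hom x ∈ component e M) : F ⟶ projection e where
  app M := ObjectProperty.homMk <|
    ModuleCat.ofHom (X := F.obj M) (Y := ((projection e).obj M).carrier)
      { toFun := fun x => (⟨(t.app M).hom.hom x, ht M x⟩, PUnit.unit)
        map_add' := fun x y =>
          Prod.ext (Subtype.ext (map_add (t.app M).hom.hom x y)) rfl
        map_smul' := fun a x => Prod.ext (Subtype.ext <| by
          change (t.app M).hom.hom (a • x) = e.symm ((e a).1, 0) • (t.app M).hom.hom x
          rw [symm_fst_zero, idem_comm, mul_smul, mem_component.1 (ht M x)]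
          exact map_smul (t.app M).hom.hom a x) rfl }
  naturality M N f := by
    ext x
    refine Prod.ext (Subtype.ext ?_) rfl
    exact congr(($(t.naturality f)).hom.hom x)

/-- A retract of the identity functor is the projection of a decomposition whose idempotent is
the value at `1 : A` of the corresponding natural idempotent. -/
theorem nonempty_iso_projection (e : A ≃+* B × C) {F : FGModuleCat.{u} A ⥤ FGModuleCat.{u} A}
    (ρ : Retract F (𝟭 _))
    (he : idem e = ((ρ.r ≫ ρ.i).app (FGModuleCat.of A A)).hom.hom (1 : A)) :
    Nonempty (F ≅ projection e) := by
  have hret (M) (x : F.obj M) : (ρ.r.app M).hom.hom ((ρ.i.app M).hom.hom x) = x :=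
    congr((($(ρ.retract)).app M).hom.hom x)
  have hidem (M : FGModuleCat.{u} A) (m : M) :
      (ρ.i.app M).hom.hom ((ρ.r.app M).hom.hom m) = idem e • m := by
    rw [he]
    exact id_natTrans_apply (ρ.r ≫ ρ.i) M m
  have hmem (M) (x : F.obj M) : (ρ.i.app M).hom.hom x ∈ component e M := by
    refine mem_component.2 ?_
    -- `idem e • i x = i (r (i x)) = i x`.
    exact (hidem M _).symm.trans (congrArg _ (hret M x))
  have happ (M) : IsIso ((liftProjection e ρ.i hmem).app M) := by
    have hb : Function.Bijective ((liftProjection e ρ.i hmem).app M).hom.hom := by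
      constructor
      · intro x y hxy
        have h1 : (ρ.i.app M).hom.hom x = (ρ.i.app M).hom.hom y :=
          congrArg (fun p : component e M × PUnit.{u + 1} => (p.1 : M)) hxy
        rw [← hret M x, h1, hret]
      · rintro ⟨m, _⟩
        refine ⟨(ρ.r.app M).hom.hom m.1, Prod.ext (Subtype.ext ?_) rfl⟩
        exact (hidem M m.1).trans (mem_component.1 m.2)
    exact (LinearEquiv.ofBijective _ hb).toFGModuleCatIso.isIso_hom
  have : IsIso (liftProjection e ρ.i hmem) := by
    rw [NatTrans.isIso_iff_isIso_app]
    exact happ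
  exact ⟨asIso (liftProjection e ρ.i hmem)⟩

/-- The natural idempotent of a retract of the identity functor is given by a central
idempotent. -/
theorem isIdempotentElem_and_central_of_retract {F : FGModuleCat.{u} A ⥤ FGModuleCat.{u} A}
    (ρ : Retract F (𝟭 _)) :
    let z : A := ((ρ.r ≫ ρ.i).app (FGModuleCat.of A A)).hom.hom (1 : A)
    IsIdempotentElem z ∧ ∀ a, z * a = a * z := by
  intro z
  have hz (a : A) : ((ρ.r ≫ ρ.i).app (FGModuleCat.of A A)).hom.hom a = z * a :=
    id_natTrans_apply _ (FGModuleCat.of A A) a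
  constructor
  · have h : (ρ.r ≫ ρ.i) ≫ ρ.r ≫ ρ.i = ρ.r ≫ ρ.i := by simp
    exact (hz z).symm.trans congr((($h).app (FGModuleCat.of A A)).hom.hom (1 : A))
  -- The endomorphism of `A` is left multiplication by `z`; being left `A`-linear, it is also right
  -- multiplication by `z`.
  · intro a
    rw [← hz]
    have := map_smul ((ρ.r ≫ ρ.i).app (FGModuleCat.of A A)).hom.hom a (1 : A)
    change _ = a * z at this
    rw [← this]
    exact congrArg _ (mul_one a).symm

end Retract

end AlgebraDecomposition

theorem mainTheorem2 {k : Type v} [Field k] [IsAlgClosed k]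
    {A : Type u} [Ring A] [Algebra k A] [FiniteDimensional k A]
    (F : FGModuleCat.{u} A ⥤ FGModuleCat.{u} A) [F.Additive] [F.Linear k]
    (hadj : Nonempty (F ⊣ F)) (hidem : Nonempty (F ⋙ F ≅ F)) :
    ∃ (B C : Type u) (_ : Ring B) (_ : Ring C) (_ : Algebra k B) (_ : Algebra k C)
      (e : A ≃ₐ[k] B × C),
      Nonempty (F ≅ AlgebraDecomposition.projection (e : A ≃+* B × C)) := by
  obtain ⟨adj⟩ := hadj
  obtain ⟨i⟩ := hidem
  have : IsNoetherianRing A := IsNoetherianRing.of_finite k A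
  obtain ⟨ρ⟩ := AlgebraDecomposition.nonempty_retract_id adj i
  obtain ⟨hz, hc⟩ := AlgebraDecomposition.isIdempotentElem_and_central_of_retract ρ
  obtain ⟨B, C, _, _, _, _, e, he⟩ :=
    AlgebraDecomposition.exists_algEquiv_prod_of_isIdempotentElem k hz hc
  exact ⟨B, C, _, _, _, _, e, AlgebraDecomposition.nonempty_iso_projection _ ρ he⟩
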